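/- Let $\mathbb{F}_q$ be the field with $q$ elements and let $C\subseteq\mathbb{F}_q^n$ be a cyclic linear code of dimension $k\ge 1$ and minimum Hamming distance $d$ (an $[n,k,d]_q$ code) that is LCD, i.e. $C\cap C^{\perp}=\{0\}$ for the Euclidean dual $C^\perp$. Then there is a quantum entanglement-assisted (QUENTA) code $Q$ with parameters $[[n,k,d;n-k]]_q$; its entanglement $c=n-k$ is maximal. If moreover $C$ is MDS ($k+d=n+1$), then this code $Q$ is MDS as well, i.e. it attains the quantum Singleton bound: $2(d-1)=n-k+c$. Here an $[[n,k,d;c]]_q$ QUENTA code is given by an isometry $V:(\mathbb{C}^q)^{\otimes k}\otimes(\mathbb{C}^q)^{\otimes c}\to(\mathbb{C}^q)^{\otimes n}$; a logical state $\psi$ is encoded as $(V\otimes I)(\psi\otimes\Phi^{\otimes c})$, where $\Phi=q^{-1/2}\sum_j|j\rangle|j\rangle$ is a maximally entangled pair shared between sender and receiver, and $V$ acts on $\psi$ and on the sender's halves. With $P$ the orthogonal projection onto the space of encoded states, an operator $E$ on the $n$ channel qudits is detectable if $P(E\otimes I)P=zP$ for some $z\in\mathbb{C}$; the minimum distance $d$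 is the least $w$ such that some operator acting on only $w$ of the $n$ channel qudits is not detectable. The code has maximal entanglement if $c=n-k$. -/

import Mathlib

open scoped Matrix Kronecker

/-! ### Linear codes of length `n` over a finite field -/

section Classical

variable {F : Type*} [Field F] {n : ℕ}

/-- The Euclidean dual code `C^⊥`. -/
def euclideanDual (C : Submodule F (Fin n → F)) : Submodule F (Fin n → F) where
  carrier := {v | ∀ c ∈ C, c ⬝ᵥ v = 0}
  add_mem' := by
    intro a b ha hb c hc
    rw [dotProduct_add, ha c hc, hb c hc, add_zero]
  zero_mem' := by
    intro c _
    exact dotProduct_zero c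
  smul_mem' := by
    intro r a ha c hc
    rw [dotProduct_smul, ha c hc, smul_zero]

/-- `C` is LCD (linear with complementary dual): `C ∩ C^⊥ = {0}`. -/
def IsLCD (C : Submodule F (Fin n → F)) : Prop :=
  C ⊓ euclideanDual C = ⊥

/-- `C` is cyclic: `(c₀, …, cₙ₋₁) ∈ C` implies `(cₙ₋₁, c₀, …, cₙ₋₂) ∈ C`. -/
def IsCyclicCode (C : Submodule F (Fin n → F)) : Prop :=
  ∀ c ∈ C, (fun i => c ((finRotate n).symm i)) ∈ C

variable [DecidableEq F]

/-- The minimum distance of `C` is `d`: the least Hamming weight of a nonzero codeword is `d`.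
(It is not defined for the zero code.) -/
def HasMinDist (C : Submodule F (Fin n → F)) (d : ℕ) : Prop :=
  IsLeast {w | ∃ c ∈ C, c ≠ 0 ∧ hammingNorm c = w} d

/-- `C` has parameters `[n, k, d]`. -/
def HasParameters (C : Submodule F (Fin n → F)) (k d : ℕ) : Prop :=
  Module.finrank F C = k ∧ HasMinDist C d

/-- `C` is MDS: it attains the Singleton bound, `k + d = n + 1`. -/
def IsMDSCode (C : Submodule F (Fin n → F)) : Prop :=
  ∃ k d, HasParameters C k d ∧ k + d = n + 1

end Classical

/-! ### Entanglement-assisted quantum codes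

The state space of `m` qudits of dimension `q` is `(ℂ^q)^{⊗ m}`. It is written in its
computational basis, so that vectors are functions on `Kets q m` and operators are matrices. -/

/-- The labels of the computational basis of `m` qudits of dimension `q`. -/
abbrev Kets (q m : ℕ) : Type := Fin m → Fin q

/-- `c` copies of the maximally entangled state `q^{-1/2} ∑ |j⟩|j⟩`; the first component of the
index belongs to the sender, the second to the receiver. -/
noncomputable def maxEntangled (q c : ℕ) : Kets q c × Kets q c → ℂ :=
  fun p => if p.1 = p.2 then ((Real.sqrt ((q : ℝ) ^ c) : ℝ) : ℂ)⁻¹ else 0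

/-- The operator `E` on `n` qudits acts on the qudits in `T` only: `E = A_T ⊗ I`. -/
def ActsOn {q n : ℕ} (T : Finset (Fin n)) (E : Matrix (Kets q n) (Kets q n) ℂ) : Prop :=
  ∃ A : Matrix (T → Fin q) (T → Fin q) ℂ, ∀ u v : Kets q n,
    E u v = if ∀ i, i ∉ T → u i = v i then A (fun i => u i) (fun i => v i) else 0

/-- A QUENTA (quantum entanglement-assisted) code, encoding `k` qudits into `n` qudits with `c`
maximally entangled pairs. The sender's encoder is an isometry from the `k` logical qudits and
her `c` halves of the pairs to the `n` qudits that are sent through the channel (in other words,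
a unitary on `n` qudits, `n - k - c` of which are ancillas in state `|0⟩`). -/
structure QuentaCode (q n k c : ℕ) where
  encoder : Matrix (Kets q n) (Kets q k × Kets q c) ℂ
  isometry : encoderᴴ * encoder = 1

namespace QuentaCode

variable {q n k c : ℕ}

/-- The codeword of the logical state `ψ`: the encoder is applied to `ψ` and to the sender's halves
of the maximally entangled pairs, the identity to the receiver's halves. It is a state of
the `n` channel qudits and the `c` receiver's qudits. -/
noncomputable def encode (Q : QuentaCode q n k c) (ψ : Kets q k → ℂ) :
    Kets q n × Kets q c → ℂ :=
  (Q.encoder ⊗ₖ (1 : Matrix (Kets q c) (Kets q c) ℂ)) *ᵥ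
    (fun p => ψ p.1.1 * maxEntangled q c (p.1.2, p.2))

/-- The error `E` on the channel qudits (the receiver's halves are free of errors) is detectable:
`⟨φ| (E ⊗ I) |ψ⟩ = z ⟨φ|ψ⟩` for all codewords, with `z` depending on `E` only; that is,
`P (E ⊗ I) P = z P` for the orthogonal projection `P` onto the code space. -/
def Detects (Q : QuentaCode q n k c) (E : Matrix (Kets q n) (Kets q n) ℂ) : Prop :=
  ∃ z : ℂ, ∀ φ ψ : Kets q k → ℂ,
    star (Q.encode φ) ⬝ᵥ ((E ⊗ₖ (1 : Matrix (Kets q c) (Kets q c) ℂ)) *ᵥ Q.encode ψ)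
      = z * (star (Q.encode φ) ⬝ᵥ Q.encode ψ)

/-- The minimum distance is `d`: every error on fewer than `d` channel qudits is detectable, and
some error on `d` channel qudits is not. -/
def HasMinDist (Q : QuentaCode q n k c) (d : ℕ) : Prop :=
  IsLeast {w | ∃ (T : Finset (Fin n)) (E : Matrix (Kets q n) (Kets q n) ℂ),
    T.card = w ∧ ActsOn T E ∧ ¬ Q.Detects E} d

/-- Maximal entanglement: `c = n - k`. -/
def IsMaximalEntanglement (_Q : QuentaCode q n k c) : Prop :=
  k + c = n

/-- The code is MDS: it attains the quantum Singleton bound `2 (d - 1) ≤ n - k + c`. -/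
def IsMDS (Q : QuentaCode q n k c) : Prop :=
  ∃ d, Q.HasMinDist d ∧ 2 * d + k = n + c + 2

end QuentaCode

/-! ### LCD codes -/

section LCD

variable {F : Type*} [Field F] {n : ℕ} {C : Submodule F (Fin n → F)}

/-! The LCD property gives `F^n = C ⊕ C^⊥`. Encode `|x⟩|s⟩` as `|L (x, s)⟩`, with `x` parametrizing
`C` and `s` parametrizing `C^⊥`; the receiver's halves record `s`. Up to normalization, an error `E`
then has logical entries `∑ s, E (L (y, s)) (L (x, s))`, and it is detectable iff this matrix is
scalar (`ofEquiv_detects_iff`). If `E` acts on fewer than `d` positions `T`, a nonzero entry forces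
`L (y - x, 0) ∈ C` to be supported in `T`, so `y = x`. The diagonal is constant because `C^⊥`
restricts onto `F^T` (`exists_dual_eqOn`): a translation of `s` absorbs `x`. Conversely, the shift
by a codeword of weight `d` is not detectable. -/

theorem IsLCD.isCompl (hC : IsLCD C) : IsCompl C (euclideanDual C) := by
  have hrefl : LinearMap.BilinForm.IsRefl (dotProductBilin F F : LinearMap.BilinForm F (Fin n → F)) :=
    fun x y h => by
      change y ⬝ᵥ x = 0
      rw [dotProduct_comm]
      exact h
  have hdual : euclideanDual C
      = LinearMap.BilinForm.orthogonal (dotProductBilin F F) C := rfl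
  rw [hdual, LinearMap.BilinForm.isCompl_orthogonal_iff_disjoint hrefl, ← hdual, disjoint_iff]
  exact hC

/-- This is `C^⊥⊥ ⊆ C`: the `C^⊥`-component of `b` is orthogonal to both summands, hence zero. -/
theorem IsLCD.mem_of_forall_dual_dotProduct_eq_zero (hC : IsLCD C) {b : Fin n → F}
    (hb : ∀ h ∈ euclideanDual C, b ⬝ᵥ h = 0) : b ∈ C := by
  obtain ⟨x, hx, y, hy, rfl⟩ := Submodule.mem_sup.1
    (hC.isCompl.sup_eq_top ▸ Submodule.mem_top : b ∈ C ⊔ euclideanDual C)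
  have hyd : ∀ h ∈ euclideanDual C, y ⬝ᵥ h = 0 := fun h hh => by
    simpa [add_dotProduct, hh x hx] using hb h hh
  have hy0 : y = 0 := dotProduct_eq_zero y fun w => by
    obtain ⟨u, hu, v, hv, rfl⟩ := Submodule.mem_sup.1
      (hC.isCompl.sup_eq_top ▸ Submodule.mem_top : w ∈ C ⊔ euclideanDual C)
    rw [dotProduct_add, hyd v hv, dotProduct_comm, hy u hu, add_zero]
  simpa [hy0] using hx

/-- The dual of an LCD code takes all values on a set of positions that supports no nonzero
codeword. -/
theorem IsLCD.exists_dual_eqOn (hC : IsLCD C) {T : Finset (Fin n)}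
    (hT : ∀ c ∈ C, (∀ i, i ∉ T → c i = 0) → c = 0) (w : Fin n → F) :
    ∃ h ∈ euclideanDual C, ∀ i ∈ T, h i = w i := by
  let K : Submodule F (Fin n → F) := LinearMap.ker (LinearMap.funLeft F F (Subtype.val : T → Fin n))
  have hK : ∀ v, v ∈ K ↔ ∀ i ∈ T, v i = 0 := fun v => by
    simp [K, funext_iff, LinearMap.funLeft_apply]
  -- Otherwise a nonzero functional `b ⬝ᵥ ·` kills both summands. Killing `C^⊥` puts `b` in `C`;
  -- killing `K` supports it in `T`.
  have htop : euclideanDual C ⊔ K = ⊤ := by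
    by_contra hne
    obtain ⟨f, hf, hle⟩ := Submodule.exists_le_ker_of_lt_top _ (lt_top_iff_ne_top.2 hne)
    obtain ⟨b, rfl⟩ := (dotProductEquiv F (Fin n)).surjective f
    have hb : b ∈ C := hC.mem_of_forall_dual_dotProduct_eq_zero fun h hh =>
      hle (Submodule.mem_sup_left hh)
    have hbT : ∀ i, i ∉ T → b i = 0 := fun i hi => by
      have : b ⬝ᵥ Pi.single i 1 = 0 := hle (Submodule.mem_sup_right ((hK _).2 fun j hj =>
        Pi.single_eq_of_ne (fun hji : j = i => hi (hji ▸ hj)) _))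
      simpa using this
    exact hf (by rw [hT b hb hbT, map_zero])
  obtain ⟨h, hh, v, hv, rfl⟩ := Submodule.mem_sup.1
    (htop ▸ Submodule.mem_top : w ∈ euclideanDual C ⊔ K)
  exact ⟨h, hh, fun i hi => by simp [(hK v).1 hv i hi]⟩

theorem hammingNorm_le_card_of_eq_zero [DecidableEq F] {T : Finset (Fin n)} {c : Fin n → F}
    (hc : ∀ i, i ∉ T → c i = 0) : hammingNorm c ≤ T.card :=
  Finset.card_le_card fun i hi => by
    by_contra h
    exact (Finset.mem_filter.1 hi).2 (hc i h)

theorem HasParameters.eq [DecidableEq F] {k d k' d' : ℕ} (h : HasParameters C k d)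
    (h' : HasParameters C k' d') : k' = k ∧ d' = d :=
  ⟨h'.1.symm.trans h.1, h'.2.unique h.2⟩

end LCD

/-! ### QUENTA codes whose encoder permutes the computational basis -/

namespace QuentaCode

variable {q n k c : ℕ}

/-- The QUENTA code whose encoder maps the basis vector `|x⟩|s⟩` to the basis vector
`|Φ (x, s)⟩`. -/
def ofEquiv (Φ : Kets q k × Kets q c ≃ Kets q n) : QuentaCode q n k c where
  encoder := Matrix.of fun u p => if u = Φ p then 1 else 0
  isometry := by
    ext p p'
    simp [Matrix.mul_apply, Matrix.one_apply, apply_ite, eq_comm]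

theorem encode_ofEquiv (Φ : Kets q k × Kets q c ≃ Kets q n) (ψ : Kets q k → ℂ)
    (p : Kets q k × Kets q c) (s : Kets q c) :
    (ofEquiv Φ).encode ψ (Φ p, s)
      = if p.2 = s then ψ p.1 * ((Real.sqrt ((q : ℝ) ^ c) : ℝ) : ℂ)⁻¹ else 0 := by
  simp only [encode, ofEquiv, Matrix.mulVec, dotProduct, Matrix.kroneckerMap_apply, Matrix.of_apply,
    Fintype.sum_prod_type, maxEntangled, Matrix.one_apply]
  rw [← Fintype.sum_prod_type' (f := fun x y => ∑ z, _), Finset.sum_eq_single p]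
  · simp [@eq_comm _ s p.2]
  · intro p' _ hp'
    simp [hp'.symm]
  · simp

/-- The action of the error `E` on the logical basis states, up to normalization. -/
noncomputable def logicalMatrix (Φ : Kets q k × Kets q c ≃ Kets q n)
    (E : Matrix (Kets q n) (Kets q n) ℂ) : Matrix (Kets q k) (Kets q k) ℂ :=
  Matrix.of fun y x => ∑ s, E (Φ (y, s)) (Φ (x, s))

theorem logicalMatrix_one (Φ : Kets q k × Kets q c ≃ Kets q n) :
    logicalMatrix Φ 1 = ((q : ℂ) ^ c) • 1 := by
  ext y x
  by_cases h : y = x <;> simp [logicalMatrix, Matrix.one_apply, h]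

/-- The receiver's halves are untouched, so only terms with the same `s` on both sides survive. -/
theorem star_encode_dotProduct_mulVec (Φ : Kets q k × Kets q c ≃ Kets q n)
    (E : Matrix (Kets q n) (Kets q n) ℂ) (φ ψ : Kets q k → ℂ) :
    star ((ofEquiv Φ).encode φ) ⬝ᵥ
        ((E ⊗ₖ (1 : Matrix (Kets q c) (Kets q c) ℂ)) *ᵥ (ofEquiv Φ).encode ψ)
      = ((((Real.sqrt ((q : ℝ) ^ c) : ℝ) : ℂ)⁻¹) ^ 2)
        * (star φ ⬝ᵥ (logicalMatrix Φ E *ᵥ ψ)) := by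
  simp only [Matrix.mulVec, dotProduct, Matrix.kroneckerMap_apply, Fintype.sum_prod_type,
    Pi.star_apply, logicalMatrix, Matrix.of_apply]
  rw [← Φ.sum_comp]
  simp_rw [← Φ.sum_comp (fun u => ∑ s, E _ u * _ * _)]
  simp only [encode_ofEquiv, Matrix.one_apply, Fintype.sum_prod_type]
  simp only [apply_ite, star_zero, star_mul', ite_mul, zero_mul, mul_zero, mul_one,
    Finset.sum_ite_eq, Finset.mem_univ, if_true, Finset.mul_sum, Finset.sum_mul]
  refine Finset.sum_congr rfl fun y _ => ?_
  conv_rhs => rw [Finset.sum_comm]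
  refine Finset.sum_congr rfl fun s _ => ?_
  rw [Finset.sum_comm]
  refine Finset.sum_congr rfl fun x _ => ?_
  rw [Finset.sum_ite_eq, if_pos (Finset.mem_univ _)]
  have hreal : star ((Real.sqrt ((q : ℝ) ^ c) : ℂ)⁻¹) = (Real.sqrt ((q : ℝ) ^ c) : ℂ)⁻¹ := by
    rw [star_inv₀, Complex.star_def, Complex.conj_ofReal]
  rw [hreal]
  ring

/-- The normalization cancels from both sides; the factor `q ^ c` of `logicalMatrix_one` rescales
`z`. -/
theorem ofEquiv_detects_iff (hq : 0 < q) (Φ : Kets q k × Kets q c ≃ Kets q n)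
    (E : Matrix (Kets q n) (Kets q n) ℂ) :
    (ofEquiv Φ).Detects E ↔ ∃ z : ℂ, logicalMatrix Φ E = z • 1 := by
  have hq' : (q : ℂ) ^ c ≠ 0 := pow_ne_zero _ (Nat.cast_ne_zero.2 hq.ne')
  have hr : (((Real.sqrt ((q : ℝ) ^ c) : ℝ) : ℂ)⁻¹) ^ 2 ≠ 0 := by
    have : (0 : ℝ) < Real.sqrt ((q : ℝ) ^ c) := by positivity
    exact pow_ne_zero _ (inv_ne_zero (Complex.ofReal_ne_zero.2 this.ne'))
  have hinner : ∀ φ ψ : Kets q k → ℂ,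
      star ((ofEquiv Φ).encode φ) ⬝ᵥ (ofEquiv Φ).encode ψ
        = ((((Real.sqrt ((q : ℝ) ^ c) : ℝ) : ℂ)⁻¹) ^ 2) * ((q : ℂ) ^ c * (star φ ⬝ᵥ ψ)) := by
    intro φ ψ
    have := star_encode_dotProduct_mulVec Φ 1 φ ψ
    rwa [Matrix.one_kronecker_one, Matrix.one_mulVec, logicalMatrix_one, Matrix.smul_mulVec,
      Matrix.one_mulVec, dotProduct_smul, smul_eq_mul] at this
  constructor
  · rintro ⟨z, hz⟩
    refine ⟨z * (q : ℂ) ^ c, ?_⟩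
    ext y x
    have h := hz (Pi.single y 1) (Pi.single x 1)
    rw [star_encode_dotProduct_mulVec, hinner, mul_left_comm] at h
    have h' := mul_left_cancel₀ hr h
    rw [Pi.star_single, star_one] at h'
    simpa [Matrix.one_apply, Pi.single_apply, mul_assoc, @eq_comm _ y x] using h'
  · rintro ⟨z, hz⟩
    refine ⟨z / (q : ℂ) ^ c, fun φ ψ => ?_⟩
    rw [star_encode_dotProduct_mulVec, hinner, hz, Matrix.smul_mulVec, Matrix.one_mulVec,
      dotProduct_smul, smul_eq_mul]
    field_simp

end QuentaCode

/-! ### The QUENTA code of an LCD code -/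

section Construction

variable {F : Type*} [Field F] {q n k : ℕ} {C : Submodule F (Fin n → F)}

theorem IsLCD.exists_linearEquiv (hC : IsLCD C) (hk : Module.finrank F C = k) :
    ∃ L : ((Fin k → F) × (Fin (n - k) → F)) ≃ₗ[F] (Fin n → F),
      (∀ x, L (x, 0) ∈ C) ∧ (∀ s, L (0, s) ∈ euclideanDual C) ∧
      (∀ v ∈ C, ∃ x, L (x, 0) = v) ∧ ∀ v ∈ euclideanDual C, ∃ s, L (0, s) = v := by
  have hsum := Submodule.finrank_add_eq_of_isCompl hC.isCompl
  rw [Module.finrank_fin_fun] at hsum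
  let g : (Fin k → F) ≃ₗ[F] C := LinearEquiv.ofFinrankEq _ _ (by simp [hk])
  let h : (Fin (n - k) → F) ≃ₗ[F] euclideanDual C :=
    LinearEquiv.ofFinrankEq _ _ (by rw [Module.finrank_fin_fun]; omega)
  refine ⟨(g.prodCongr h).trans (Submodule.prodEquivOfIsCompl _ _ hC.isCompl), ?_, ?_, ?_, ?_⟩
  · intro x; simp
  · intro s; simp
  · intro v hv; exact ⟨g.symm ⟨v, hv⟩, by simp⟩
  · intro v hv; exact ⟨h.symm ⟨v, hv⟩, by simp⟩

/-- The relabelling of basis states by vectors over the alphabet `F`. -/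
def ketsEquiv (e : F ≃ Fin q) (m : ℕ) : (Fin m → F) ≃ Kets q m :=
  Equiv.piCongrRight fun _ => e

/-- The bijection of basis states given by a linear bijection. -/
def ketsEquivOfLinearEquiv {c : ℕ} (e : F ≃ Fin q)
    (L : ((Fin k → F) × (Fin c → F)) ≃ₗ[F] (Fin n → F)) : Kets q k × Kets q c ≃ Kets q n :=
  ((ketsEquiv e k).prodCongr (ketsEquiv e c)).symm.trans (L.toEquiv.trans (ketsEquiv e n))

theorem logicalMatrix_apply_ketsEquiv [Fintype F] {c : ℕ} (e : F ≃ Fin q)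
    (L : ((Fin k → F) × (Fin c → F)) ≃ₗ[F] (Fin n → F)) (E : Matrix (Kets q n) (Kets q n) ℂ)
    (y x : Fin k → F) :
    QuentaCode.logicalMatrix (ketsEquivOfLinearEquiv e L) E (ketsEquiv e k y) (ketsEquiv e k x)
      = ∑ s, E (ketsEquiv e n (L (y, s))) (ketsEquiv e n (L (x, s))) := by
  simp [QuentaCode.logicalMatrix, ketsEquivOfLinearEquiv, ← (ketsEquiv e c).sum_comp]

/-- The error that shifts the basis states by the vector `c`. -/
def shiftError (e : F ≃ Fin q) (c : Fin n → F) : Matrix (Kets q n) (Kets q n) ℂ :=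
  Matrix.of fun u v => if u = ketsEquiv e n ((ketsEquiv e n).symm v + c) then 1 else 0

theorem actsOn_shiftError (e : F ≃ Fin q) {c : Fin n → F} {T : Finset (Fin n)}
    (hc : ∀ i, i ∉ T → c i = 0) : ActsOn T (shiftError e c) := by
  refine ⟨Matrix.of fun u v => if ∀ i : T, u i = e (e.symm (v i) + c i) then 1 else 0,
    fun u v => ?_⟩
  have hiff : u = ketsEquiv e n ((ketsEquiv e n).symm v + c) ↔
      (∀ i, i ∉ T → u i = v i) ∧ ∀ i : T, u i = e (e.symm (v i) + c i) := by
    change u = (fun i => e (e.symm (v i) + c i)) ↔ _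
    rw [funext_iff]
    constructor
    · intro h
      exact ⟨fun i hi => by rw [h i, hc i hi]; simp, fun i => h i⟩
    · rintro ⟨h1, h2⟩ i
      by_cases hi : i ∈ T
      · exact h2 ⟨i, hi⟩
      · rw [h1 i hi, hc i hi]; simp
  simp only [shiftError, Matrix.of_apply, hiff, ite_and]

variable [Fintype F] {e : F ≃ Fin q} {L : ((Fin k → F) × (Fin (n - k) → F)) ≃ₗ[F] (Fin n → F)}

/-- Errors on positions that support no nonzero codeword of the LCD code are detectable. -/
theorem IsLCD.exists_logicalMatrix_eq_smul (hC : IsLCD C) (hL : ∀ x, L (x, 0) ∈ C)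
    (hL' : ∀ v ∈ euclideanDual C, ∃ s, L (0, s) = v) {T : Finset (Fin n)}
    (hT : ∀ c ∈ C, (∀ i, i ∉ T → c i = 0) → c = 0) {E : Matrix (Kets q n) (Kets q n) ℂ}
    (hE : ActsOn T E) :
    ∃ z : ℂ, QuentaCode.logicalMatrix (ketsEquivOfLinearEquiv e L) E = z • 1 := by
  obtain ⟨A, hA⟩ := hE
  refine ⟨QuentaCode.logicalMatrix (ketsEquivOfLinearEquiv e L) E
    (ketsEquiv e k 0) (ketsEquiv e k 0), ?_⟩
  ext y x
  obtain ⟨y, rfl⟩ := (ketsEquiv e k).surjective y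
  obtain ⟨x, rfl⟩ := (ketsEquiv e k).surjective x
  have hsub : ∀ (y x : Fin k → F) (s t : Fin (n - k) → F),
      L (y, s) - L (x, t) = L (y - x, s - t) := fun y x s t => by
    rw [← map_sub]; rfl
  rw [Matrix.smul_apply, Matrix.one_apply, logicalMatrix_apply_ketsEquiv,
    logicalMatrix_apply_ketsEquiv]
  split_ifs with hyx
  · obtain rfl := (ketsEquiv e k).injective hyx
    -- On `T`, the dual word `L (0, s₀)` imitates `L (y, 0)`, so translating the sum by `s₀` turns
    -- the entry at `0` into the entry at `y`.
    obtain ⟨h, hh, hhT⟩ := hC.exists_dual_eqOn hT (L (y, 0))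
    obtain ⟨s₀, rfl⟩ := hL' h hh
    rw [smul_eq_mul, mul_one, ← Equiv.sum_comp (Equiv.addRight s₀)
      fun s => E (ketsEquiv e n (L (0, s))) (ketsEquiv e n (L (0, s)))]
    refine Finset.sum_congr rfl fun s _ => ?_
    have key : ∀ i : T, ketsEquiv e n (L (y, s)) i = ketsEquiv e n (L (0, s + s₀)) i := by
      intro i
      have h1 : L (y, s) = L (y, 0) + L (0, s) := by rw [← map_add]; simp
      have h2 : L (0, s + s₀) = L (0, s₀) + L (0, s) := by rw [← map_add]; simp [add_comm]
      change e (L (y, s) i) = e (L (0, s + s₀) i)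
      rw [h1, h2, Pi.add_apply, Pi.add_apply, hhT i i.2]
    simp only [hA, Equiv.coe_addRight, key, implies_true, if_true]
  · rw [smul_zero]
    refine Finset.sum_eq_zero fun s _ => ?_
    rw [hA, if_neg]
    intro hoff
    apply hyx
    -- The two words share `s` and agree off `T`, so their difference is a codeword supported in
    -- `T`.
    have h0 : L (y - x, 0) = 0 := hT _ (hL _) fun i hi => by
      have := e.injective (hoff i hi)
      rw [← sub_self s, ← hsub, Pi.sub_apply, this, sub_self]
    have := (Prod.ext_iff.1 (L.map_eq_zero_iff.1 h0)).1
    rw [sub_eq_zero.1 this]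

/-- The shift by a nonzero codeword acts nontrivially on the code space. -/
theorem logicalMatrix_shiftError_ne_smul {x : Fin k → F} (hx : x ≠ 0) (z : ℂ) :
    QuentaCode.logicalMatrix (ketsEquivOfLinearEquiv e L) (shiftError e (L (x, 0))) ≠ z • 1 := by
  intro h
  -- At the entry `(x, 0)` every summand is `1`, so the sum is the number of `s`, whereas a scalar
  -- matrix vanishes there.
  have h1 := congrFun (congrFun h (ketsEquiv e k x)) (ketsEquiv e k 0)
  have hadd : ∀ s, L (0, s) + L (x, 0) = L (x, s) := fun s => by rw [← map_add]; simp
  rw [logicalMatrix_apply_ketsEquiv, Matrix.smul_apply,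
    Matrix.one_apply_ne ((ketsEquiv e k).injective.ne hx)] at h1
  simp [shiftError, hadd] at h1

end Construction

theorem mainTheorem9 {F : Type*} [Field F] [Fintype F] [DecidableEq F]
    (q n k d : ℕ) (hq : Fintype.card F = q)
    (C : Submodule F (Fin n → F)) (hcyc : IsCyclicCode C) (hLCD : IsLCD C)
    (hC : HasParameters C k d) :
    ∃ Q : QuentaCode q n k (n - k),
      Q.IsMaximalEntanglement ∧ Q.HasMinDist d ∧ (IsMDSCode C → Q.IsMDS) := by
  have hq0 : 0 < q := hq ▸ Fintype.card_pos
  have hkn : k ≤ n := by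
    simpa [hC.1] using Submodule.finrank_le C
  let e : F ≃ Fin q := Fintype.equivFinOfCardEq hq
  obtain ⟨L, hL, -, hLC, hL'⟩ := hLCD.exists_linearEquiv hC.1
  have hdist : (QuentaCode.ofEquiv (ketsEquivOfLinearEquiv e L)).HasMinDist d := by
    constructor
    · obtain ⟨c, hc, hc0, hcd⟩ := hC.2.1
      obtain ⟨x, rfl⟩ := hLC c hc
      -- The set of positions is the support of the minimum-weight codeword.
      refine ⟨_, shiftError e (L (x, 0)), hcd, actsOn_shiftError e fun i hi => ?_, ?_⟩
      · simpa using hi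
      · rw [QuentaCode.ofEquiv_detects_iff hq0]
        rintro ⟨z, hz⟩
        refine logicalMatrix_shiftError_ne_smul (fun hx => hc0 ?_) z hz
        rw [hx]
        exact map_zero L
    · rintro _ ⟨T, E, rfl, hE, hdet⟩
      by_contra! hlt
      refine hdet ((QuentaCode.ofEquiv_detects_iff hq0 _ _).2
        (hLCD.exists_logicalMatrix_eq_smul hL hL' (fun c hc hcT => ?_) hE))
      by_contra hc0
      have := hC.2.2 ⟨c, hc, hc0, rfl⟩
      exact absurd (this.trans (hammingNorm_le_card_of_eq_zero hcT)) (not_le.2 hlt)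
  refine ⟨QuentaCode.ofEquiv (ketsEquivOfLinearEquiv e L), Nat.add_sub_cancel' hkn, hdist, ?_⟩
  rintro ⟨k', d', hC', hMDS⟩
  obtain ⟨rfl, rfl⟩ := hC.eq hC'
  -- For `c = n - k` the quantum Singleton equality is twice the classical one.
  exact ⟨d', hdist, by omega⟩
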